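/- Let $\Phi:\mathbb{R}^n\to\mathbb{R}^m$ and $D^*:\mathbb{R}^n\to\mathbb{R}^p$ be linear maps, let $x_0\in\mathbb{R}^n$ and $y_0:=\Phi x_0$; $\|\cdot\|$ denotes the Euclidean norm. Let $\mathbb{R}^p=\bigoplus_{g=1}^q V_g$ be a direct sum of subspaces $V_g$ of the same dimension $G$, write $u=\sum_{g=1}^q u_g$ with $u_g\in V_g$ for $u\in\mathbb{R}^p$, and put $\|u\|_{\ell_1/\ell_2}:=\sum_{g=1}^q\|u_g\|$ and $J(x):=\|D^*x\|_{\ell_1/\ell_2}$ for $x\in\mathbb{R}^n$. **Corollary (Robust recovery and solution uniqueness for group-sparsity problems).** The following statements are equivalent: (i) $x_0$ is the unique solution of $\min_{x\in\mathbb{R}^n} J(x)$ subject to $\Phi x=\Phi x_0$. (ii) There are constants $C$ and $\delta_0>0$ such that for all $0<\delta<\delta_0$, all $y\in\mathbb{R}^m$ with $\|y-y_0\|\le\delta$, and every solution $x_\delta$ of $\min_{x\in\mathbb{R}^n} J(x)$ subject to $\|y-\Phi x\|\le\delta$, one has $\|x_\delta-x_0\|\le C\sqrt{\delta}$. (iii)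 For every $c_1>0$ there are constants $C$ and $\delta_0>0$ such that for all $0<\delta<\delta_0$, all $y\in\mathbb{R}^m$ with $\|y-y_0\|\le\delta$, and every solution $x_\mu$ of $\min_{x\in\mathbb{R}^n}\frac12\|\Phi x-y\|^2+\mu J(x)$ with $\mu=c_1\delta$, one has $\|x_\mu-x_0\|\le C\sqrt{\delta}$. -/

import Mathlib

noncomputable section

/-- For an (internal) direct sum decomposition `ℝᵖ = ⨁ g, V g` and `u ∈ ℝᵖ`, the vector
`u_g ∈ V g` of the unique representation `u = ∑ g, u_g` with `u_g ∈ V g`. -/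
def groupPart {p q : ℕ} {V : Fin q → Submodule ℝ (EuclideanSpace ℝ (Fin p))}
    (hV : DirectSum.IsInternal V) (g : Fin q) (u : EuclideanSpace ℝ (Fin p)) :
    EuclideanSpace ℝ (Fin p) :=
  ((LinearEquiv.ofBijective (DirectSum.coeLinearMap V) hV).symm u g :
    EuclideanSpace ℝ (Fin p))

theorem groupPart_mem {p q : ℕ} {V : Fin q → Submodule ℝ (EuclideanSpace ℝ (Fin p))}
    (hV : DirectSum.IsInternal V) (g : Fin q) (u : EuclideanSpace ℝ (Fin p)) :
    groupPart hV g u ∈ V g :=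
  Submodule.coe_mem _

theorem sum_groupPart {p q : ℕ} {V : Fin q → Submodule ℝ (EuclideanSpace ℝ (Fin p))}
    (hV : DirectSum.IsInternal V) (u : EuclideanSpace ℝ (Fin p)) :
    ∑ g, groupPart hV g u = u := by
  have h : DirectSum.coeLinearMap V
      ((LinearEquiv.ofBijective (DirectSum.coeLinearMap V) hV).symm u) = u :=
    (LinearEquiv.ofBijective (DirectSum.coeLinearMap V) hV).apply_symm_apply u
  rw [DirectSum.coeLinearMap_eq_dfinsuppSum,
    DFinsupp.sum_eq_sum_fintype _ (fun _ => rfl)] at h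
  exact h

/-- The `ℓ₁/ℓ₂` norm `∑ g, ‖u_g‖` attached to the groups `V g`. -/
def normL1L2 {p q : ℕ} {V : Fin q → Submodule ℝ (EuclideanSpace ℝ (Fin p))}
    (hV : DirectSum.IsInternal V) (u : EuclideanSpace ℝ (Fin p)) : ℝ :=
  ∑ g, ‖groupPart hV g u‖

/-- `x` is a (global) solution of the problem of minimizing `f` over the feasible set `s`. -/
def IsSolution {X : Type*} (f : X → ℝ) (s : Set X) (x : X) : Prop :=
  x ∈ s ∧ IsMinOn f s x

/-- `x` is the unique solution of the problem of minimizing `f` over the feasible set `s`. -/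
def IsUniqueSolution {X : Type*} (f : X → ℝ) (s : Set X) (x : X) : Prop :=
  IsSolution f s x ∧ ∀ z, IsSolution f s z → z = x

/-- The group-sparsity regularizer `J(x) = ‖D* x‖_{ℓ₁/ℓ₂}`. -/
def groupReg {n p q : ℕ} {V : Fin q → Submodule ℝ (EuclideanSpace ℝ (Fin p))}
    (hV : DirectSum.IsInternal V)
    (Dstar : EuclideanSpace ℝ (Fin n) →ₗ[ℝ] EuclideanSpace ℝ (Fin p))
    (x : EuclideanSpace ℝ (Fin n)) : ℝ :=
  normL1L2 hV (Dstar x)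

/-- `x₀` is the unique solution of: minimize `J(x)` subject to `Φ x = Φ x₀`. -/
def IsUniqueExactSolution {n m : ℕ}
    (Φ : EuclideanSpace ℝ (Fin n) →ₗ[ℝ] EuclideanSpace ℝ (Fin m))
    (J : EuclideanSpace ℝ (Fin n) → ℝ) (x₀ : EuclideanSpace ℝ (Fin n)) : Prop :=
  IsUniqueSolution J {x | Φ x = Φ x₀} x₀

/-- `x` is a solution of: minimize `J(x)` subject to `‖y - Φ x‖ ≤ δ`. -/
def IsConstrainedSolution {n m : ℕ}
    (Φ : EuclideanSpace ℝ (Fin n) →ₗ[ℝ] EuclideanSpace ℝ (Fin m))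
    (J : EuclideanSpace ℝ (Fin n) → ℝ) (y : EuclideanSpace ℝ (Fin m)) (δ : ℝ)
    (x : EuclideanSpace ℝ (Fin n)) : Prop :=
  IsSolution J {x | ‖y - Φ x‖ ≤ δ} x

/-- `x` is a solution of: minimize `½ ‖Φ x - y‖² + μ J(x)` over `ℝⁿ`. -/
def IsPenalizedSolution {n m : ℕ}
    (Φ : EuclideanSpace ℝ (Fin n) →ₗ[ℝ] EuclideanSpace ℝ (Fin m))
    (J : EuclideanSpace ℝ (Fin n) → ℝ) (y : EuclideanSpace ℝ (Fin m)) (μ : ℝ)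
    (x : EuclideanSpace ℝ (Fin n)) : Prop :=
  IsSolution (fun x => (1 / 2 : ℝ) * ‖Φ x - y‖ ^ 2 + μ * J x) Set.univ x

end

open Filter Topology

/-! `J x = ‖B x‖`, where `B` lists the group parts of `D* x` in an ℓ¹ sum. The key fact is that
uniqueness in (i) self-improves to quadratic growth of `J` on `x₀ + ker Φ`
(`quadratic_growth_sum_norm`). Each group norm is bounded below, and along rays above, by the same
directional derivative and curvature up to constants. A strict minimizer therefore has nonnegative
derivative and no direction where both vanish, and compactness of the sphere gives a uniform
constant. Growth, convexity and the openness of `Φ` onto its range give the √δ error bound, hence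
(ii) and (iii). Conversely, a minimizer `z` on the fibre exists and has a Lagrange multiplier, which
makes `z` solve the noisy problems for suitable `y` at arbitrarily small `δ`. The estimate then
forces `z = x₀`. -/

/-! ### Second-order bounds for the Euclidean norm -/

theorem norm_add_sq_of_unit {F : Type*} [NormedAddCommGroup F] [InnerProductSpace ℝ F]
    {a : F} (ha : a ≠ 0) (u : F) :
    ‖a + u‖ ^ 2 = (‖a‖ + inner ℝ a u / ‖a‖) ^ 2 + (‖u‖ ^ 2 - (inner ℝ a u / ‖a‖) ^ 2) := by
  have h : ‖a‖ ≠ 0 := norm_ne_zero_iff.mpr ha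
  rw [norm_add_sq_real]
  field_simp
  ring

/-- The one-sided directional derivative of the norm at `a` in the direction `u`. -/
noncomputable def normDirDeriv {F : Type*} [NormedAddCommGroup F] [InnerProductSpace ℝ F]
    (a u : F) : ℝ := open Classical in if a = 0 then ‖u‖ else inner ℝ a u / ‖a‖

/-- The squared norm of the part of `u` orthogonal to `a`, set to `0` when `a = 0`. -/
noncomputable def normCurvature {F : Type*} [NormedAddCommGroup F] [InnerProductSpace ℝ F]
    (a u : F) : ℝ := open Classical in if a = 0 then 0 else ‖u‖ ^ 2 - (inner ℝ a u / ‖a‖) ^ 2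

section
variable {F : Type*} [NormedAddCommGroup F] [InnerProductSpace ℝ F]

theorem abs_inner_div_norm_le (a u : F) : |inner ℝ a u / ‖a‖| ≤ ‖u‖ := by
  rw [abs_div, abs_norm]
  exact div_le_of_le_mul₀ (norm_nonneg _) (norm_nonneg _)
    (by rw [mul_comm]; exact abs_real_inner_le_norm a u)

theorem normCurvature_nonneg (a u : F) : 0 ≤ normCurvature a u := by
  unfold normCurvature
  split_ifs
  · exact le_rfl
  · have := sq_le_sq' (abs_le.mp (abs_inner_div_norm_le a u)).1
      (abs_le.mp (abs_inner_div_norm_le a u)).2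
    linarith

theorem continuous_normDirDeriv (a : F) : Continuous (normDirDeriv a) := by
  unfold normDirDeriv
  split_ifs <;> fun_prop

theorem continuous_normCurvature (a : F) : Continuous (normCurvature a) := by
  unfold normCurvature
  split_ifs <;> fun_prop

theorem normDirDeriv_smul (a u : F) {t : ℝ} (ht : 0 ≤ t) :
    normDirDeriv a (t • u) = t * normDirDeriv a u := by
  unfold normDirDeriv
  split_ifs
  · rw [norm_smul, Real.norm_of_nonneg ht]
  · rw [real_inner_smul_right, mul_div_assoc]

theorem normCurvature_smul (a u : F) (t : ℝ) :
    normCurvature a (t • u) = t ^ 2 * normCurvature a u := by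
  unfold normCurvature
  split_ifs
  · simp
  · rw [real_inner_smul_right, mul_div_assoc, norm_smul, mul_pow, mul_pow, Real.norm_eq_abs, sq_abs]
    ring

/-- With `d` the derivative, the curvature is `(‖a + u‖ - ‖a‖ - d) * (‖a + u‖ + ‖a‖ + d)`, and the
second factor is at most `2‖a‖ + 2R`. -/
theorem norm_add_lower (a : F) {u : F} {R : ℝ} (hR : 0 < R) (hu : ‖u‖ ≤ R) :
    normDirDeriv a u + (2 * ‖a‖ + 2 * R)⁻¹ * normCurvature a u ≤ ‖a + u‖ - ‖a‖ := by
  by_cases ha : a = 0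
  · simp [normDirDeriv, normCurvature, ha]
  have hq := normCurvature_nonneg a u
  have hs := norm_add_sq_of_unit ha u
  have hd := abs_le.mp (abs_inner_div_norm_le a u)
  have htri := norm_add_le a u
  have hap := norm_pos_iff.mpr ha
  simp only [normDirDeriv, normCurvature, if_neg ha] at hq ⊢
  set d := inner ℝ a u / ‖a‖
  set s := ‖u‖ ^ 2 - d ^ 2
  have hge : ‖a‖ + d ≤ ‖a + u‖ := by
    nlinarith [norm_nonneg (a + u)]
  rw [inv_mul_eq_div, ← le_sub_iff_add_le', div_le_iff₀ (by positivity)]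
  have : s = (‖a + u‖ - ‖a‖ - d) * (‖a + u‖ + (‖a‖ + d)) := by linarith [hs]
  rw [this]
  apply mul_le_mul_of_nonneg_left <;> linarith

/-- Same factorization: for small `t` the second factor is at least `‖a‖`. -/
theorem norm_add_smul_upper (a u : F) :
    ∃ C, 0 ≤ C ∧ ∀ᶠ t : ℝ in 𝓝[>] 0,
      ‖a + t • u‖ - ‖a‖ ≤ t * normDirDeriv a u + C * (t ^ 2 * normCurvature a u) := by
  by_cases ha : a = 0
  · refine ⟨0, le_rfl, ?_⟩
    filter_upwards [self_mem_nhdsWithin] with t ht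
    simp [normDirDeriv, ha, norm_smul, abs_of_pos (Set.mem_Ioi.mp ht)]
  have hap := norm_pos_iff.mpr ha
  refine ⟨‖a‖⁻¹, by positivity, ?_⟩
  have hlim : Tendsto (fun t : ℝ => ‖a‖ + t * normDirDeriv a u) (𝓝[>] 0) (𝓝 ‖a‖) := by
    have : Continuous (fun t : ℝ => ‖a‖ + t * normDirDeriv a u) := by fun_prop
    simpa using (this.tendsto 0).mono_left nhdsWithin_le_nhds
  filter_upwards [self_mem_nhdsWithin, hlim.eventually (lt_mem_nhds (half_lt_self hap))]
    with t ht hlt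
  have hq := normCurvature_nonneg a (t • u)
  have hs := norm_add_sq_of_unit ha (t • u)
  rw [← normCurvature_smul, ← normDirDeriv_smul a u (Set.mem_Ioi.mp ht).le] at *
  simp only [normDirDeriv, normCurvature, if_neg ha] at hq hlt ⊢
  set d := inner ℝ a (t • u) / ‖a‖
  set s := ‖t • u‖ ^ 2 - d ^ 2
  have hge : ‖a‖ + d ≤ ‖a + t • u‖ := by
    nlinarith [norm_nonneg (a + t • u)]
  rw [inv_mul_eq_div, ← sub_le_iff_le_add', le_div_iff₀ hap]
  have : s = (‖a + t • u‖ - ‖a‖ - d) * (‖a + t • u‖ + (‖a‖ + d)) := by linarith [hs]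
  rw [this]
  apply mul_le_mul_of_nonneg_left <;> linarith

end

/-! ### Quadratic growth at a strict minimizer -/

section
variable {E : Type*} [NormedAddCommGroup E] [InnerProductSpace ℝ E] [FiniteDimensional ℝ E]
  {F : Type*} [NormedAddCommGroup F] [InnerProductSpace ℝ F]

/-- A strict minimizer of a sum of norms of linear maps over `x₀ + K` is a minimizer of
order two. -/
theorem quadratic_growth_sum_norm {ι : Type*} [Fintype ι] (A : ι → E →ₗ[ℝ] F)
    (K : Submodule ℝ E) (x₀ : E)
    (hx : ∀ k ∈ K, k ≠ 0 → ∑ i, ‖A i x₀‖ < ∑ i, ‖A i (x₀ + k)‖) :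
    ∃ c > 0, ∀ k ∈ K, ‖k‖ ≤ 1 →
      c * ‖k‖ ^ 2 ≤ ∑ i, ‖A i (x₀ + k)‖ - ∑ i, ‖A i x₀‖ := by
  have hcont (i) : Continuous (A i) := (A i).continuous_of_finiteDimensional
  have hR (i) : ∃ R : ℝ, 0 < R ∧ ∀ k, ‖k‖ ≤ 1 → ‖A i k‖ ≤ R := by
    refine ⟨‖LinearMap.toContinuousLinearMap (A i)‖ + 1, by positivity, fun k hk => ?_⟩
    have := (LinearMap.toContinuousLinearMap (A i)).le_opNorm k
    simp only [LinearMap.coe_toContinuousLinearMap'] at this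
    nlinarith [norm_nonneg (LinearMap.toContinuousLinearMap (A i)), norm_nonneg k]
  choose R hRpos hR using hR
  set r : ι → ℝ := fun i => (2 * ‖A i x₀‖ + 2 * R i)⁻¹ with hr
  have hrpos (i) : 0 < r i := by
    have := hRpos i
    simp only [hr]
    positivity
  set D : E → ℝ := fun k => ∑ i, normDirDeriv (A i x₀) (A i k)
  set Q : E → ℝ := fun k => ∑ i, r i * normCurvature (A i x₀) (A i k)
  have hDc : Continuous D :=
    continuous_finsetSum _ fun i _ => (continuous_normDirDeriv _).comp (hcont i)
  have hQc : Continuous Q :=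
    continuous_finsetSum _ fun i _ =>
      continuous_const.mul ((continuous_normCurvature _).comp (hcont i))
  have hQ0 (k) : 0 ≤ Q k :=
    Finset.sum_nonneg fun i _ => mul_nonneg (hrpos i).le (normCurvature_nonneg _ _)
  have hDs (k) {t : ℝ} (ht : 0 ≤ t) : D (t • k) = t * D k := by
    simp only [D, map_smul, Finset.mul_sum]
    exact Finset.sum_congr rfl fun i _ => normDirDeriv_smul _ _ ht
  have hQs (k) (t : ℝ) : Q (t • k) = t ^ 2 * Q k := by
    simp only [Q, map_smul, Finset.mul_sum, normCurvature_smul]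
    exact Finset.sum_congr rfl fun i _ => by ring
  have hlow (k : E) (hk : ‖k‖ ≤ 1) :
      D k + Q k ≤ ∑ i, ‖A i (x₀ + k)‖ - ∑ i, ‖A i x₀‖ := by
    simp only [D, Q, ← Finset.sum_add_distrib, ← Finset.sum_sub_distrib, map_add]
    exact Finset.sum_le_sum fun i _ => norm_add_lower _ (hRpos i) (hR i k hk)
  -- The upper bound uses the same `D` and `Q` as `hlow`, so `D k = Q k = 0` would contradict
  -- strictness.
  have hup (k : E) : ∃ C, 0 ≤ C ∧ ∀ᶠ t : ℝ in 𝓝[>] 0,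
      ∑ i, ‖A i (x₀ + t • k)‖ - ∑ i, ‖A i x₀‖ ≤ t * D k + C * (t ^ 2 * Q k) := by
    choose C hC0 hC using fun i => norm_add_smul_upper (A i x₀) (A i k)
    refine ⟨∑ i, C i * (r i)⁻¹,
      Finset.sum_nonneg fun i _ => mul_nonneg (hC0 i) (inv_pos.mpr (hrpos i)).le, ?_⟩
    filter_upwards [eventually_all.mpr hC] with t ht
    have h1 : ∑ i, C i * (t ^ 2 * normCurvature (A i x₀) (A i k)) ≤
        (∑ i, C i * (r i)⁻¹) * (t ^ 2 * Q k) := by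
      rw [Finset.sum_mul]
      refine Finset.sum_le_sum fun i _ => ?_
      have h2 : r i * normCurvature (A i x₀) (A i k) ≤ Q k :=
        Finset.single_le_sum
          (f := fun i => r i * normCurvature (A i x₀) (A i k))
          (fun i _ => mul_nonneg (hrpos i).le (normCurvature_nonneg _ _)) (Finset.mem_univ i)
      rw [mul_assoc]
      refine mul_le_mul_of_nonneg_left ?_ (hC0 i)
      rw [inv_mul_eq_div, le_div_iff₀ (hrpos i)]
      nlinarith [sq_nonneg t]
    refine le_trans ?_ (add_le_add_right h1 _)
    simp only [D, Finset.mul_sum, ← Finset.sum_add_distrib, ← Finset.sum_sub_distrib, map_add,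
      map_smul]
    exact Finset.sum_le_sum fun i _ => ht i
  have hpos : ∀ k ∈ K, k ≠ 0 → 0 ≤ D k ∧ 0 < D k + Q k := by
    intro k hk hk0
    obtain ⟨C, hC0, hC⟩ := hup k
    have hev : ∀ᶠ t : ℝ in 𝓝[>] 0, 0 < D k + C * (t * Q k) := by
      filter_upwards [hC, self_mem_nhdsWithin] with t ht htpos
      have htpos : 0 < t := htpos
      have := hx (t • k) (K.smul_mem t hk) (smul_ne_zero htpos.ne' hk0)
      have h3 : 0 < t * (D k + C * (t * Q k)) := by linarith
      exact pos_of_mul_pos_right h3 htpos.le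
    have hD : 0 ≤ D k := by
      have hlim : Tendsto (fun t : ℝ => D k + C * (t * Q k)) (𝓝[>] 0) (𝓝 (D k)) := by
        have : Continuous (fun t : ℝ => D k + C * (t * Q k)) := by fun_prop
        simpa using (this.tendsto 0).mono_left nhdsWithin_le_nhds
      exact ge_of_tendsto hlim (hev.mono fun _ h => h.le)
    refine ⟨hD, ?_⟩
    rcases (hQ0 k).eq_or_lt with h | h
    · obtain ⟨t, ht⟩ := hev.exists
      simpa [← h] using ht
    · linarith
  have hcomp : IsCompact (Metric.sphere (0 : E) 1 ∩ K) :=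
    (isCompact_sphere 0 1).inter_right K.closed_of_finiteDimensional
  obtain ⟨c, hc, hcle⟩ : ∃ c > 0, ∀ w ∈ Metric.sphere (0 : E) 1 ∩ K, c ≤ D w + Q w := by
    refine hcomp.exists_forall_le' (hDc.add hQc).continuousOn fun w hw => (hpos w hw.2 ?_).2
    rintro rfl
    simpa using hw.1
  refine ⟨c, hc, fun k hk hk1 => le_trans ?_ (hlow k hk1)⟩
  rcases eq_or_ne k 0 with rfl | hk0
  · have h1 := hDs 0 le_rfl
    have h2 := hQ0 0
    simp only [smul_zero, zero_mul] at h1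
    simpa [h1] using h2
  have hn : 0 < ‖k‖ := norm_pos_iff.mpr hk0
  have hw := hcle (‖k‖⁻¹ • k) ⟨by simp [norm_smul, hn.ne'], K.smul_mem _ hk⟩
  rw [hDs _ (inv_pos.mpr hn).le, hQs] at hw
  have hD := (hpos k hk hk0).1
  -- The first-order term scales as `‖k‖`, not `‖k‖ ^ 2`; `D k ≥ 0` and `‖k‖ ≤ 1` absorb the
  -- difference.
  calc c * ‖k‖ ^ 2 ≤ (‖k‖⁻¹ * D k + ‖k‖⁻¹ ^ 2 * Q k) * ‖k‖ ^ 2 := by gcongr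
    _ = ‖k‖ * D k + Q k := by field_simp
    _ ≤ D k + Q k := by nlinarith

end

/-! ### Error bound, existence of minimizers, multipliers -/

section
variable {E : Type*} [NormedAddCommGroup E] [InnerProductSpace ℝ E]
  {F : Type*} [NormedAddCommGroup F] [InnerProductSpace ℝ F]
  {W : Type*} [NormedAddCommGroup W] [NormedSpace ℝ W]

theorem exists_mem_ker_norm_sub_le [FiniteDimensional ℝ E] (Φ : E →ₗ[ℝ] F) :
    ∃ C > 0, ∀ h, ∃ k ∈ LinearMap.ker Φ, ‖h - k‖ ≤ C * ‖Φ h‖ := by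
  obtain ⟨C, hC, hle⟩ := ContinuousLinearMap.exists_preimage_norm_le
    (LinearMap.toContinuousLinearMap Φ.rangeRestrict) Φ.surjective_rangeRestrict
  refine ⟨C, hC, fun h => ?_⟩
  obtain ⟨x, hx, hxn⟩ := hle (Φ.rangeRestrict h)
  refine ⟨h - x, ?_, by simpa using hxn⟩
  have : Φ x = Φ h := congrArg Subtype.val hx
  simp [this]

/-- Quadratic growth of `‖B x‖` on the fibre of `Φ` through `x₀` gives a Hölder error bound. -/
theorem error_bound_of_growth [FiniteDimensional ℝ E] (Φ : E →ₗ[ℝ] F) (B : E →ₗ[ℝ] W) (x₀ : E)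
    (hg : ∃ c > 0, ∀ k ∈ LinearMap.ker Φ, ‖k‖ ≤ 1 → c * ‖k‖ ^ 2 ≤ ‖B (x₀ + k)‖ - ‖B x₀‖) :
    ∃ K C s₀ : ℝ, 0 ≤ K ∧ 0 ≤ C ∧ 0 < s₀ ∧
      (∀ x, ‖B x₀‖ - K * ‖Φ (x - x₀)‖ ≤ ‖B x‖) ∧
      ∀ s, 0 ≤ s → s < s₀ → ∀ x, ‖Φ (x - x₀)‖ ≤ s → ‖B x‖ - ‖B x₀‖ ≤ s →
        ‖x - x₀‖ ≤ C * √s := by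
  obtain ⟨c, hc, hgrow⟩ := hg
  obtain ⟨L, hL, hdec⟩ := exists_mem_ker_norm_sub_le Φ
  set M := ‖LinearMap.toContinuousLinearMap B‖
  have hM : 0 ≤ M := norm_nonneg _
  have hB (x) : ‖B x‖ ≤ M * ‖x‖ := (LinearMap.toContinuousLinearMap B).le_opNorm x
  have hlip (x k) : ‖B (x₀ + k)‖ ≤ ‖B x‖ + M * ‖x - x₀ - k‖ := by
    have h1 : B (x₀ + k) = B x - B (x - x₀ - k) := by rw [← map_sub]; congr 1; abel
    rw [h1]
    exact (norm_sub_le _ _).trans (add_le_add_right (hB _) _)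
  -- By convexity, the growth `c` attained on the unit sphere persists outside the ball.
  have hbig : ∀ k ∈ LinearMap.ker Φ, ‖B (x₀ + k)‖ - ‖B x₀‖ < c → ‖k‖ ≤ 1 := by
    intro k hk hlt
    by_contra! hk1
    have hkpos : 0 < ‖k‖ := by linarith
    have h1 := hgrow (‖k‖⁻¹ • k) ((LinearMap.ker Φ).smul_mem _ hk)
      (by rw [norm_smul, norm_inv, norm_norm, inv_mul_cancel₀ hkpos.ne'])
    rw [norm_smul, norm_inv, norm_norm, inv_mul_cancel₀ hkpos.ne'] at h1
    have h2 : B (x₀ + ‖k‖⁻¹ • k) = (1 - ‖k‖⁻¹) • B x₀ + ‖k‖⁻¹ • B (x₀ + k) := by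
      simp only [map_add, map_smul]; module
    have hi1 : ‖k‖⁻¹ < 1 := inv_lt_one_of_one_lt₀ hk1
    have hi0 : 0 < ‖k‖⁻¹ := inv_pos.mpr hkpos
    have h3 : ‖B (x₀ + ‖k‖⁻¹ • k)‖ ≤ (1 - ‖k‖⁻¹) * ‖B x₀‖ + ‖k‖⁻¹ * ‖B (x₀ + k)‖ := by
      rw [h2]
      refine (norm_add_le _ _).trans_eq ?_
      rw [norm_smul, norm_smul, Real.norm_of_nonneg (by linarith), Real.norm_of_nonneg hi0.le]
    nlinarith
  have hmin : ∀ k ∈ LinearMap.ker Φ, ‖B x₀‖ ≤ ‖B (x₀ + k)‖ := by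
    intro k hk
    by_contra! hlt
    have := hgrow k hk (hbig k hk (by linarith))
    nlinarith [sq_nonneg ‖k‖]
  -- Excess `s` at `x`, plus `M * L * s` for moving to the fibre. Below, `s < 1` gives `s ≤ √s`, and
  -- `s < c / a` permits `hbig`.
  set a := 1 + M * L with ha
  have hapos : 0 < a := by positivity
  refine ⟨M * L, √(a / c) + L, min 1 (c / a), by positivity, by positivity,
    lt_min one_pos (by positivity), fun x => ?_, fun s hs0 hs x hΦ hJ => ?_⟩
  · obtain ⟨k, hk, hle⟩ := hdec (x - x₀)
    have h1 := hlip x k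
    have h2 := hmin k hk
    have := mul_le_mul_of_nonneg_left hle hM
    linarith
  · obtain ⟨k, hk, hle⟩ := hdec (x - x₀)
    have h1 := hlip x k
    have h2 : ‖x - x₀ - k‖ ≤ L * s := hle.trans (by gcongr)
    have h3 := mul_le_mul_of_nonneg_left h2 hM
    have h4 : ‖B (x₀ + k)‖ - ‖B x₀‖ ≤ a * s := by rw [ha]; linarith
    have h5 : a * s < c := by
      rw [mul_comm, ← lt_div_iff₀ hapos]; exact hs.trans_le (min_le_right _ _)
    have h6 := hgrow k hk (hbig k hk (by linarith))
    have h7 : ‖k‖ ≤ √(a / c) * √s := by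
      rw [← Real.sqrt_mul (by positivity)]
      apply Real.le_sqrt_of_sq_le
      rw [div_mul_eq_mul_div, le_div_iff₀ hc]
      linarith
    have h8 : s ≤ √s := by
      apply Real.le_sqrt_of_sq_le
      have := hs.trans_le (min_le_left _ _)
      nlinarith
    have h9 : ‖x - x₀‖ ≤ ‖k‖ + ‖x - x₀ - k‖ := by
      simpa using norm_add_le k (x - x₀ - k)
    have := mul_le_mul_of_nonneg_left h8 hL.le
    linarith

/-- `‖B ·‖` need not be coercive, but `B (ker Φ)` is a closed subspace, so `B x₀` has a nearest
point in it. -/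
theorem exists_min_on_fibre [FiniteDimensional ℝ E] [FiniteDimensional ℝ W]
    (Φ : E →ₗ[ℝ] F) (B : E →ₗ[ℝ] W) (x₀ : E) :
    ∃ z, Φ z = Φ x₀ ∧ ∀ x, Φ x = Φ x₀ → ‖B z‖ ≤ ‖B x‖ := by
  set S := (LinearMap.ker Φ).map B
  obtain ⟨w, hw, hd⟩ := S.closed_of_finiteDimensional.exists_infDist_eq_dist S.nonempty (B x₀)
  obtain ⟨k, hk, rfl⟩ := hw
  have hk : Φ k = 0 := hk
  refine ⟨x₀ - k, by simp [hk], fun x hx => ?_⟩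
  have h := Metric.infDist_le_dist_of_mem (x := B x₀) (s := (S : Set W)) (y := B (x₀ - x))
    ⟨x₀ - x, by simp [hx], rfl⟩
  rw [hd] at h
  simpa [dist_eq_norm] using h

/-- Existence of a Lagrange multiplier for the problem `min ‖B x‖` subject to `Φ x = Φ z`. -/
theorem exists_multiplier [FiniteDimensional ℝ F] (Φ : E →ₗ[ℝ] F) (B : E →ₗ[ℝ] W) {z : E}
    (hz : ∀ x, Φ x = Φ z → ‖B z‖ ≤ ‖B x‖) :
    ∃ v : F, ∀ x, ‖B z‖ + inner ℝ v (Φ (x - z)) ≤ ‖B x‖ := by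
  by_cases hzk : z ∈ LinearMap.ker Φ
  · refine ⟨0, fun x => ?_⟩
    have := hz 0 (by simpa using hzk.symm)
    simp only [map_zero, norm_zero] at this
    simpa using this.trans (norm_nonneg _)
  -- Hahn–Banach from `ker Φ ⊕ ℝ z`: zero on the kernel, `‖B z‖` at `z`. The extension kills `ker
  -- Φ`, so it factors through `Φ`.
  let f₀ : E →ₗ.[ℝ] ℝ := ⟨LinearMap.ker Φ, 0⟩
  let f : E →ₗ.[ℝ] ℝ := f₀.supSpanSingleton z ‖B z‖ hzk
  obtain ⟨g, hgf, hg⟩ := exists_extension_of_le_sublinear f (fun x => ‖B x‖)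
    (fun c hc x => by simp [norm_smul, abs_of_pos hc])
    (fun x y => by rw [map_add]; exact norm_add_le _ _) (by
      rintro ⟨x, hx⟩
      obtain ⟨k, hk, t', ht, rfl⟩ := Submodule.mem_sup.mp hx
      obtain ⟨t, rfl⟩ := Submodule.mem_span_singleton.mp ht
      have hk : Φ k = 0 := hk
      refine (LinearPMap.supSpanSingleton_apply_mk f₀ _ _ hzk k hk t).trans_le ?_
      change 0 + _ ≤ _
      simp only [zero_add, RingHom.id_apply, smul_eq_mul]
      rcases le_or_gt t 0 with h | h
      · exact (mul_nonpos_of_nonpos_of_nonneg h (norm_nonneg _)).trans (norm_nonneg _)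
      · have h1 := hz (z + t⁻¹ • k) (by simp [hk])
        have h2 : k + t • z = t • (z + t⁻¹ • k) := by
          rw [smul_add, smul_smul, mul_inv_cancel₀ h.ne', one_smul, add_comm]
        rw [h2, map_smul, norm_smul, Real.norm_of_nonneg h.le]
        gcongr)
  have hgz : g z = ‖B z‖ :=
    (hgf ⟨z, Submodule.mem_sup_right (Submodule.mem_span_singleton_self z)⟩).trans
      (LinearPMap.supSpanSingleton_apply_self f₀ _ hzk)
  have hgk : g ∈ (LinearMap.ker Φ).dualAnnihilator := by
    rw [Submodule.mem_dualAnnihilator]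
    intro k hk
    exact (hgf ⟨k, Submodule.mem_sup_left hk⟩).trans
      (LinearPMap.supSpanSingleton_apply_mk_of_mem f₀ _ hzk hk)
  rw [← LinearMap.range_dualMap_eq_dualAnnihilator_ker] at hgk
  obtain ⟨l, rfl⟩ := hgk
  refine ⟨(InnerProductSpace.toDual ℝ F).symm (LinearMap.toContinuousLinearMap l), fun x => ?_⟩
  have h := hg x
  simp only [LinearMap.dualMap_apply] at h hgz
  rw [InnerProductSpace.toDual_symm_apply, LinearMap.coe_toContinuousLinearMap', map_sub, map_sub,
    hgz]
  linarith

end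

theorem eq_of_norm_sub_le_sqrt {E : Type*} [NormedAddCommGroup E] {x z : E} {C δ₀ : ℝ}
    (hδ₀ : 0 < δ₀) (h : ∀ δ, 0 < δ → δ < δ₀ → ‖z - x‖ ≤ C * √δ) : z = x := by
  have hlim : Tendsto (fun δ : ℝ => C * √δ) (𝓝[>] 0) (𝓝 0) := by
    have : Continuous (fun δ : ℝ => C * √δ) := by fun_prop
    simpa using (this.tendsto 0).mono_left nhdsWithin_le_nhds
  have hle : ‖z - x‖ ≤ 0 := by
    refine ge_of_tendsto hlim ?_
    filter_upwards [Ioo_mem_nhdsGT hδ₀] with δ hδ using h δ hδ.1 hδ.2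
  exact sub_eq_zero.mp (norm_le_zero_iff.mp hle)

/-! ### The constrained and penalized problems -/

section
variable {n m : ℕ} {Φ : EuclideanSpace ℝ (Fin n) →ₗ[ℝ] EuclideanSpace ℝ (Fin m)}
  {W : Type*} [NormedAddCommGroup W] [NormedSpace ℝ W] {B : EuclideanSpace ℝ (Fin n) →ₗ[ℝ] W}
  {x₀ : EuclideanSpace ℝ (Fin n)}

theorem IsUniqueExactSolution.lt {J : EuclideanSpace ℝ (Fin n) → ℝ}
    (h : IsUniqueExactSolution Φ J x₀) {k : EuclideanSpace ℝ (Fin n)}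
    (hk : k ∈ LinearMap.ker Φ) (hk0 : k ≠ 0) : J x₀ < J (x₀ + k) := by
  by_contra! hle
  have hk : Φ k = 0 := hk
  have := h.2 (x₀ + k) ⟨by simp [hk], fun x hx => hle.trans (h.1.2 hx)⟩
  exact hk0 (by simpa using this)

theorem constrained_bound {C s₀ : ℝ} (hs₀ : 0 < s₀)
    (herr : ∀ s, 0 ≤ s → s < s₀ → ∀ x, ‖Φ (x - x₀)‖ ≤ s → ‖B x‖ - ‖B x₀‖ ≤ s →
      ‖x - x₀‖ ≤ C * √s) :
    ∃ C δ₀ : ℝ, 0 < δ₀ ∧ ∀ δ : ℝ, 0 < δ → δ < δ₀ →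
      ∀ y : EuclideanSpace ℝ (Fin m), ‖y - Φ x₀‖ ≤ δ →
        ∀ x, IsConstrainedSolution Φ (fun x => ‖B x‖) y δ x → ‖x - x₀‖ ≤ C * √δ := by
  refine ⟨C * √2, s₀ / 2, by positivity, fun δ hδ hlt y hy x hx => ?_⟩
  have hf : ‖y - Φ x‖ ≤ δ := hx.1
  have hJ : ‖B x‖ ≤ ‖B x₀‖ := hx.2 hy
  have h1 : ‖Φ (x - x₀)‖ ≤ 2 * δ := by
    have := norm_sub_le (y - Φ x₀) (y - Φ x)
    rw [sub_sub_sub_cancel_left, ← map_sub] at this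
    linarith
  have := herr (2 * δ) (by positivity) (by linarith) x h1 (by linarith)
  rwa [Real.sqrt_mul zero_le_two, ← mul_assoc] at this

theorem penalized_bound {K C s₀ : ℝ} (hK : 0 ≤ K) (hs₀ : 0 < s₀)
    (hlow : ∀ x, ‖B x₀‖ - K * ‖Φ (x - x₀)‖ ≤ ‖B x‖)
    (herr : ∀ s, 0 ≤ s → s < s₀ → ∀ x, ‖Φ (x - x₀)‖ ≤ s → ‖B x‖ - ‖B x₀‖ ≤ s →
      ‖x - x₀‖ ≤ C * √s) {c₁ : ℝ} (hc₁ : 0 < c₁) :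
    ∃ C δ₀ : ℝ, 0 < δ₀ ∧ ∀ δ : ℝ, 0 < δ → δ < δ₀ →
      ∀ y : EuclideanSpace ℝ (Fin m), ‖y - Φ x₀‖ ≤ δ →
        ∀ x, IsPenalizedSolution Φ (fun x => ‖B x‖) y (c₁ * δ) x → ‖x - x₀‖ ≤ C * √δ := by
  -- `2 + 2 * c₁ * K` controls `‖Φ (x - x₀)‖ / δ`, and `1 / (2 * c₁)` the excess of `‖B x‖` over
  -- `δ`.
  set b := 2 + 2 * c₁ * K + 1 / (2 * c₁) with hb
  have hbpos : 0 < b := by positivity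
  refine ⟨C * √b, s₀ / b, by positivity, fun δ hδ hlt y hy x hx => ?_⟩
  have hopt : 1 / 2 * ‖Φ x - y‖ ^ 2 + c₁ * δ * ‖B x‖ ≤
      1 / 2 * ‖Φ x₀ - y‖ ^ 2 + c₁ * δ * ‖B x₀‖ := hx.2 (Set.mem_univ x₀)
  rw [norm_sub_rev] at hy
  set r := ‖Φ x - y‖
  set e := ‖Φ x₀ - y‖
  have hr : 0 ≤ r := norm_nonneg _
  have he : 0 ≤ e := norm_nonneg _
  have hΦ : ‖Φ (x - x₀)‖ ≤ r + δ := by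
    have := norm_sub_le (Φ x - y) (Φ x₀ - y)
    rw [sub_sub_sub_cancel_right, ← map_sub] at this
    linarith
  have he2 : e ^ 2 ≤ δ ^ 2 := pow_le_pow_left₀ he hy 2
  have hcδ : 0 < c₁ * δ := by positivity
  have hJ : ‖B x‖ - ‖B x₀‖ ≤ δ / (2 * c₁) := by
    rw [le_div_iff₀ (by positivity)]
    have : δ * ((‖B x‖ - ‖B x₀‖) * (2 * c₁)) ≤ δ * δ := by nlinarith
    exact le_of_mul_le_mul_left this hδ
  have hres : r ≤ δ * (1 + 2 * c₁ * K) := by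
    have h1 : ‖B x₀‖ - ‖B x‖ ≤ K * (r + δ) := by
      have := mul_le_mul_of_nonneg_left hΦ hK
      linarith [hlow x]
    have h2 := mul_le_mul_of_nonneg_left h1 hcδ.le
    -- Optimality bounds `r ^ 2 - δ ^ 2`; cancelling `r + δ` leaves a residual linear in `δ`.
    have h3 : (r + δ) * (r - δ) ≤ (r + δ) * (2 * c₁ * δ * K) := by nlinarith
    have := le_of_mul_le_mul_left h3 (by linarith)
    linarith
  have hq : δ / (2 * c₁) = δ * (1 / (2 * c₁)) := by ring
  have hq0 : 0 ≤ δ * (1 / (2 * c₁)) := by positivity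
  have hp0 : 0 ≤ δ * (2 + 2 * c₁ * K) := by positivity
  have hbδ : b * δ = δ * (2 + 2 * c₁ * K) + δ * (1 / (2 * c₁)) := by rw [hb]; ring
  have := herr (b * δ) (by positivity) (by rwa [lt_div_iff₀' hbpos] at hlt) x
    (by linarith) (by linarith)
  rwa [Real.sqrt_mul hbpos.le, ← mul_assoc] at this

theorem isUniqueExactSolution_of_forall [FiniteDimensional ℝ W]
    (h : ∀ z, Φ z = Φ x₀ → (∃ v : EuclideanSpace ℝ (Fin m),
      ∀ x, ‖B z‖ + inner ℝ v (Φ (x - z)) ≤ ‖B x‖) → z = x₀) :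
    IsUniqueExactSolution Φ (fun x => ‖B x‖) x₀ := by
  have h' (z) (hz : Φ z = Φ x₀) (hmin : ∀ x, Φ x = Φ x₀ → ‖B z‖ ≤ ‖B x‖) : z = x₀ :=
    h z hz (exists_multiplier Φ B fun x hx => hmin x (hx.trans hz))
  obtain ⟨z, hz, hmin⟩ := exists_min_on_fibre Φ B x₀
  obtain rfl := h' z hz hmin
  exact ⟨⟨rfl, hmin⟩, fun w hw => h' w hw.1 fun x hx => hw.2 hx⟩

/-- Shift the data by `δ` along `v / ‖v‖`: Cauchy–Schwarz then gives `⟪v, Φ (x - z)⟫ ≥ 0` for every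
feasible `x`. For `v = 0` the shift is zero. -/
theorem isConstrainedSolution_of_multiplier {z : EuclideanSpace ℝ (Fin n)}
    {v : EuclideanSpace ℝ (Fin m)} (hv : ∀ x, ‖B z‖ + inner ℝ v (Φ (x - z)) ≤ ‖B x‖)
    {δ : ℝ} (hδ : 0 ≤ δ) :
    ∃ y, ‖y - Φ z‖ ≤ δ ∧ IsConstrainedSolution Φ (fun x => ‖B x‖) y δ z := by
  have hnorm : ‖(δ * ‖v‖⁻¹) • v‖ ≤ δ := by
    rw [norm_smul, Real.norm_of_nonneg (by positivity), mul_assoc]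
    exact mul_le_of_le_one_right hδ inv_mul_le_one
  refine ⟨Φ z + (δ * ‖v‖⁻¹) • v, by simpa using hnorm, by simpa using hnorm, fun x hx => ?_⟩
  have hx : ‖Φ z + (δ * ‖v‖⁻¹) • v - Φ x‖ ≤ δ := hx
  refine le_trans ?_ (hv x)
  have h1 := real_inner_le_norm v (Φ z + (δ * ‖v‖⁻¹) • v - Φ x)
  have h2 : inner ℝ v (Φ z + (δ * ‖v‖⁻¹) • v - Φ x) =
      δ * ‖v‖ - inner ℝ v (Φ (x - z)) := by
    rw [add_sub_right_comm, inner_add_right, real_inner_smul_right, real_inner_self_eq_norm_sq,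
      ← neg_sub, inner_neg_right, ← map_sub]
    rcases eq_or_ne ‖v‖ 0 with h | h
    · simp [h]
    · field_simp
      ring
  have h3 := mul_le_mul_of_nonneg_left hx (norm_nonneg v)
  change ‖B z‖ ≤ _
  linarith

/-- With residual `-μ • v` the linear terms are absorbed by the multiplier inequality, leaving `½‖Φ
(x - z)‖ ^ 2 ≥ 0`. -/
theorem isPenalizedSolution_of_multiplier {z : EuclideanSpace ℝ (Fin n)}
    {v : EuclideanSpace ℝ (Fin m)} (hv : ∀ x, ‖B z‖ + inner ℝ v (Φ (x - z)) ≤ ‖B x‖)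
    {μ : ℝ} (hμ : 0 ≤ μ) :
    IsPenalizedSolution Φ (fun x => ‖B x‖) (Φ z + μ • v) μ z := by
  refine ⟨Set.mem_univ _, fun x _ => ?_⟩
  change 1 / 2 * ‖Φ z - (Φ z + μ • v)‖ ^ 2 + μ * ‖B z‖ ≤
    1 / 2 * ‖Φ x - (Φ z + μ • v)‖ ^ 2 + μ * ‖B x‖
  have h1 : Φ x - (Φ z + μ • v) = Φ (x - z) - μ • v := by rw [map_sub]; abel
  rw [h1, sub_add_cancel_left, norm_neg, norm_sub_sq_real, real_inner_smul_right,
    real_inner_comm]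
  have := mul_le_mul_of_nonneg_left (hv x) hμ
  nlinarith [sq_nonneg ‖Φ (x - z)‖]

end

/-! ### The group regularizer and the equivalence -/

/-- The map `x ↦ ((D* x)_g)_g`, with values in the `ℓ¹` sum of the groups. -/
noncomputable def groupMap {n p q : ℕ} {V : Fin q → Submodule ℝ (EuclideanSpace ℝ (Fin p))}
    (hV : DirectSum.IsInternal V)
    (Dstar : EuclideanSpace ℝ (Fin n) →ₗ[ℝ] EuclideanSpace ℝ (Fin p)) :
    EuclideanSpace ℝ (Fin n) →ₗ[ℝ] PiLp 1 (fun _ : Fin q => EuclideanSpace ℝ (Fin p)) where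
  toFun x := WithLp.toLp 1 fun g => groupPart hV g (Dstar x)
  map_add' x y := by ext; simp [groupPart]
  map_smul' c x := by ext; simp [groupPart, DirectSum.smul_apply]

theorem norm_groupMap {n p q : ℕ} {V : Fin q → Submodule ℝ (EuclideanSpace ℝ (Fin p))}
    (hV : DirectSum.IsInternal V)
    (Dstar : EuclideanSpace ℝ (Fin n) →ₗ[ℝ] EuclideanSpace ℝ (Fin p))
    (x : EuclideanSpace ℝ (Fin n)) : ‖groupMap hV Dstar x‖ = groupReg hV Dstar x :=
  PiLp.norm_eq_of_L1 _

theorem groupReg_quadratic_growth {n m p q : ℕ}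
    {Φ : EuclideanSpace ℝ (Fin n) →ₗ[ℝ] EuclideanSpace ℝ (Fin m)}
    {V : Fin q → Submodule ℝ (EuclideanSpace ℝ (Fin p))} (hV : DirectSum.IsInternal V)
    (Dstar : EuclideanSpace ℝ (Fin n) →ₗ[ℝ] EuclideanSpace ℝ (Fin p))
    {x₀ : EuclideanSpace ℝ (Fin n)} (h : IsUniqueExactSolution Φ (groupReg hV Dstar) x₀) :
    ∃ c > 0, ∀ k ∈ LinearMap.ker Φ, ‖k‖ ≤ 1 →
      c * ‖k‖ ^ 2 ≤ ‖groupMap hV Dstar (x₀ + k)‖ - ‖groupMap hV Dstar x₀‖ := by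
  simp only [PiLp.norm_eq_of_L1]
  refine quadratic_growth_sum_norm
    (fun g => (PiLp.projₗ 1 (𝕜 := ℝ) (fun _ : Fin q => EuclideanSpace ℝ (Fin p)) g) ∘ₗ
      groupMap hV Dstar) (LinearMap.ker Φ) x₀ fun k hk hk0 => h.lt hk hk0

theorem mainTheorem11 {n m p q : ℕ}
    (Φ : EuclideanSpace ℝ (Fin n) →ₗ[ℝ] EuclideanSpace ℝ (Fin m))
    (Dstar : EuclideanSpace ℝ (Fin n) →ₗ[ℝ] EuclideanSpace ℝ (Fin p))
    (V : Fin q → Submodule ℝ (EuclideanSpace ℝ (Fin p)))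
    (hV : DirectSum.IsInternal V)
    (G : ℕ) (hG : ∀ g, Module.finrank ℝ (V g) = G)
    (x₀ : EuclideanSpace ℝ (Fin n)) :
    List.TFAE
      [ IsUniqueExactSolution Φ (groupReg hV Dstar) x₀,
        ∃ C δ₀ : ℝ, 0 < δ₀ ∧ ∀ δ : ℝ, 0 < δ → δ < δ₀ →
          ∀ y : EuclideanSpace ℝ (Fin m), ‖y - Φ x₀‖ ≤ δ →
            ∀ x : EuclideanSpace ℝ (Fin n),
              IsConstrainedSolution Φ (groupReg hV Dstar) y δ x → ‖x - x₀‖ ≤ C * √δ,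
        ∀ c₁ : ℝ, 0 < c₁ → ∃ C δ₀ : ℝ, 0 < δ₀ ∧ ∀ δ : ℝ, 0 < δ → δ < δ₀ →
          ∀ y : EuclideanSpace ℝ (Fin m), ‖y - Φ x₀‖ ≤ δ →
            ∀ x : EuclideanSpace ℝ (Fin n),
              IsPenalizedSolution Φ (groupReg hV Dstar) y (c₁ * δ) x →
                ‖x - x₀‖ ≤ C * √δ ] := by

  have hreg : groupReg hV Dstar = fun x => ‖groupMap hV Dstar x‖ :=
    funext fun x => (norm_groupMap hV Dstar x).symm
  tfae_have 1 → 2 := fun h => by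
    obtain ⟨K, C, s₀, hK, hC, hs₀, hlow, herr⟩ :=
      error_bound_of_growth Φ _ x₀ (groupReg_quadratic_growth hV Dstar h)
    rw [hreg]
    exact constrained_bound hs₀ herr
  tfae_have 1 → 3 := fun h c₁ hc₁ => by
    obtain ⟨K, C, s₀, hK, hC, hs₀, hlow, herr⟩ :=
      error_bound_of_growth Φ _ x₀ (groupReg_quadratic_growth hV Dstar h)
    rw [hreg]
    exact penalized_bound hK hs₀ hlow herr hc₁
  tfae_have 2 → 1 := by
    rw [hreg]
    rintro ⟨C, δ₀, hδ₀, h⟩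
    refine isUniqueExactSolution_of_forall fun z hz ⟨v, hv⟩ =>
      eq_of_norm_sub_le_sqrt (C := C) hδ₀ fun δ hδ hlt => ?_
    obtain ⟨y, hy, hsol⟩ := isConstrainedSolution_of_multiplier hv hδ.le
    exact h δ hδ hlt y (hz ▸ hy) z hsol
  tfae_have 3 → 1 := by
    rw [hreg]
    intro h
    refine isUniqueExactSolution_of_forall fun z hz ⟨v, hv⟩ => ?_
    -- The freedom in `c₁` is needed here: the data `Φ z + (c₁ * δ) • v` must lie within `δ` of `Φ
    -- x₀`, that is, `c₁ * ‖v‖ ≤ 1`.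
    obtain ⟨C, δ₀, hδ₀, h⟩ := h (‖v‖ + 1)⁻¹ (by positivity)
    refine eq_of_norm_sub_le_sqrt (C := C) hδ₀ fun δ hδ hlt => ?_
    refine h δ hδ hlt _ ?_ z (isPenalizedSolution_of_multiplier hv (by positivity))
    rw [hz, add_sub_cancel_left, norm_smul, Real.norm_of_nonneg (by positivity), mul_right_comm]
    refine mul_le_of_le_one_left hδ.le ?_
    rw [inv_mul_eq_div, div_le_one (by positivity)]
    linarith
  tfae_finish
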